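/- Let $-\infty\le x_0<y_0\le+\infty$, let $a,b:(x_0,y_0)\to\mathbb R$ be continuous with $a(x)>0$ for all $x$, and consider the one-dimensional diffusion generator $\mathcal L f=a f''+b f'$ on $(x_0,y_0)$. Fix $c\in(x_0,y_0)$ and let $$s'(x)=\exp\Big(-\int_c^x\frac{b(t)}{a(t)}\,dt\Big),\qquad m'(x)=\frac1{a(x)}\exp\Big(\int_c^x\frac{b(t)}{a(t)}\,dt\Big)$$ be the derivatives of the scale and speed functions. Assume that the speed measure is finite, $Z:=\int_{x_0}^{y_0}m'(x)\,dx<\infty$, and that the endpoints are not accessible: $$\int_c^{y_0}s'(x)\int_c^x m'(t)\,dt\,dx=\int_{x_0}^c s'(x)\int_x^c m'(t)\,dt\,dx=+\infty .$$ Let $\mu(dx)=m'(x)\,dx/Z$, and consider the Dirichlet form $\mathcal E(h,h)=\int_{x_0}^{y_0}a\,(h')^2\,d\mu$ whose domain $\mathbb D(\mathcal E)$ consists of the $h\in L^2(\mu)$ that are absolutely continuous on every compact subinterval of $(x_0,y_0)$ and satisfy $\mathcal E(h,h)<\infty$. For a probability measure $\nu$ on $(x_0,y_0)$ let $I(\nu|\mu)=\mathcal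 E(\sqrt f,\sqrt f)$ if $\nu=f\mu$ with $\sqrt f\in\mathbb D(\mathcal E)$, and $I(\nu|\mu)=+\infty$ otherwise. For a metric $d$ on $(x_0,y_0)$ let $W_1(\nu,\mu)=\inf_\pi\iint d(x,y)\,\pi(dx,dy)$, where $\pi$ runs over the couplings of $\nu$ and $\mu$. One says that $\mu$ satisfies $W_1I(K)$ on $((x_0,y_0),d)$ if $$W_1(\nu,\mu)^2\le 4K^2\,I(\nu|\mu)\qquad\text{for all probability measures }\nu\text{ on }(x_0,y_0).$$ For $\rho\in C^1(x_0,y_0)\cap L^1(\mu)$ with $\rho'>0$ everywhere, put $d_\rho(x,y)=|\rho(x)-\rho(y)|$ and $$C(\rho)=\sup_{x\in(x_0,y_0)}\frac{s'(x)}{\rho'(x)}\int_x^{y_0}\big[\rho(t)-\mu(\rho)\big]m'(t)\,dt .$$ 1. Let $\rho\in C^1(x_0,y_0)\cap L^2(\mu)$ with $\rho'>0$ everywhere. If $C(\rho)<\infty$ and $\sigma:=\sup_{x\in(x_0,y_0)}\sqrt{a(x)}\,\rho'(x)<\infty$, then $\mu$ satisfies $W_1I(\sigma C(\rho))$ on $((x_0,y_0),d_\rho)$.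 2. In particular, let $\rho_a(x)=\int_c^x a(t)^{-1/2}\,dt$. If $\rho_a\in L^1(\mu)$ and $C(\rho_a)<\infty$, then $\mu$ satisfies $W_1I(C(\rho_a))$ on $((x_0,y_0),d_{\rho_a})$. -/

import Mathlib

open MeasureTheory Set
open scoped ENNReal

noncomputable section

/-- The couplings of `ν` and `μ`: measures on the product whose marginals are `ν` and `μ`. -/
def IsCoupling {X : Type*} [MeasurableSpace X] (π : Measure (X × X)) (ν μ : Measure X) : Prop :=
  π.map Prod.fst = ν ∧ π.map Prod.snd = μ

/-- The `L¹`-Wasserstein distance for the distance function `d` (its value may be `∞`). -/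
def wassersteinOne {X : Type*} [MeasurableSpace X] (d : X → X → ℝ) (ν μ : Measure X) : ℝ≥0∞ :=
  ⨅ (π : Measure (X × X)) (_ : IsCoupling π ν μ), ∫⁻ p, ENNReal.ofReal (d p.1 p.2) ∂π

namespace OneDimDiffusion

/-- The open interval `(x₀, y₀)` of the real line; the endpoints may be infinite. -/
def stateSpace (x₀ y₀ : EReal) : Set ℝ := {x : ℝ | x₀ < (x : EReal) ∧ (x : EReal) < y₀}

/-- The derivative `s'` of the scale function, normalised at `c`. -/
def scaleDeriv (a b : ℝ → ℝ) (c x : ℝ) : ℝ := Real.exp (-∫ t in c..x, b t / a t)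

/-- The derivative `m'` of the speed function, normalised at `c`. -/
def speedDeriv (a b : ℝ → ℝ) (c x : ℝ) : ℝ := 1 / a x * Real.exp (∫ t in c..x, b t / a t)

/-- The total mass `Z` of the speed measure has to be finite. -/
def FiniteSpeed (x₀ y₀ : EReal) (a b : ℝ → ℝ) (c : ℝ) : Prop :=
  ∫⁻ x in stateSpace x₀ y₀, ENNReal.ofReal (speedDeriv a b c x) < ∞

/-- Neither endpoint is accessible, in Feller's classification. -/
def NonAccessible (x₀ y₀ : EReal) (a b : ℝ → ℝ) (c : ℝ) : Prop :=
  (∫⁻ x in stateSpace x₀ y₀ ∩ Ioi c, ENNReal.ofReal (scaleDeriv a b c x) *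
      ∫⁻ t in Ioo c x, ENNReal.ofReal (speedDeriv a b c t)) = ∞ ∧
  (∫⁻ x in stateSpace x₀ y₀ ∩ Iio c, ENNReal.ofReal (scaleDeriv a b c x) *
      ∫⁻ t in Ioo x c, ENNReal.ofReal (speedDeriv a b c t)) = ∞

/-- The total mass `Z` of the speed measure. -/
def speedMass (x₀ y₀ : EReal) (a b : ℝ → ℝ) (c : ℝ) : ℝ :=
  ∫ x in stateSpace x₀ y₀, speedDeriv a b c x

/-- The measure `μ(dx) = m'(x) dx / Z` on `(x₀, y₀)`, as a measure on `ℝ` carried by `(x₀, y₀)`. -/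
def invMeasure (x₀ y₀ : EReal) (a b : ℝ → ℝ) (c : ℝ) : Measure ℝ :=
  (volume.restrict (stateSpace x₀ y₀)).withDensity
    fun x => ENNReal.ofReal (speedDeriv a b c x / speedMass x₀ y₀ a b c)

/-- Absolute continuity on the open interval, i.e. on each of its compact subintervals. -/
def IsAC (x₀ y₀ : EReal) (h : ℝ → ℝ) : Prop :=
  ∀ u ∈ stateSpace x₀ y₀, ∀ v ∈ stateSpace x₀ y₀, AbsolutelyContinuousOnInterval h u v

/-- The Dirichlet form `ℰ(h, h) = ∫ a (h')² dμ`. The derivative of an absolutely continuous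
function exists almost everywhere. -/
def energy (x₀ y₀ : EReal) (a b : ℝ → ℝ) (c : ℝ) (h : ℝ → ℝ) : ℝ≥0∞ :=
  ∫⁻ x, ENNReal.ofReal (a x * deriv h x ^ 2) ∂(invMeasure x₀ y₀ a b c)

/-- The domain of the Dirichlet form. -/
def FormDomain (x₀ y₀ : EReal) (a b : ℝ → ℝ) (c : ℝ) (h : ℝ → ℝ) : Prop :=
  IsAC x₀ y₀ h ∧ MemLp h 2 (invMeasure x₀ y₀ a b c) ∧ energy x₀ y₀ a b c h < ∞

/-- The Fisher information: `ℰ(√f, √f)` if `ν = f μ` with `√f` in the domain of the form, and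
`∞` otherwise. As `μ` has a positive density on `(x₀, y₀)`, at most one version of the density
has a continuous square root there, so the infimum is over at most one value;
the infimum of the empty family is `∞`. -/
def fisherInfo (x₀ y₀ : EReal) (a b : ℝ → ℝ) (c : ℝ) (ν : Measure ℝ) : ℝ≥0∞ :=
  ⨅ (f : ℝ → ℝ) (_ : (∀ x, 0 ≤ f x) ∧
      ν = (invMeasure x₀ y₀ a b c).withDensity (fun x => ENNReal.ofReal (f x)) ∧
      FormDomain x₀ y₀ a b c (fun x => √(f x))),
    energy x₀ y₀ a b c (fun x => √(f x))

/-- The transportation-information inequality `W₁I(K)` of `μ` on `(x₀, y₀)` with the metric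
`d_ρ(x, y) = |ρ x - ρ y|`. Probability measures on `(x₀, y₀)` are the probability measures on `ℝ`
that do not charge its complement. -/
def SatisfiesW1I (x₀ y₀ : EReal) (a b : ℝ → ℝ) (c : ℝ) (ρ : ℝ → ℝ) (K : ℝ) : Prop :=
  ∀ ν : Measure ℝ, IsProbabilityMeasure ν → ν (stateSpace x₀ y₀)ᶜ = 0 →
    wassersteinOne (fun x y => |ρ x - ρ y|) ν (invMeasure x₀ y₀ a b c) ^ 2 ≤
      4 * ENNReal.ofReal K ^ 2 * fisherInfo x₀ y₀ a b c ν

/-- The function `x ↦ (s'(x) / ρ'(x)) ∫ₓ^{y₀} (ρ(t) - μ(ρ)) m'(t) dt` on `(x₀, y₀)`. -/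
def lipRatio (x₀ y₀ : EReal) (a b : ℝ → ℝ) (c : ℝ) (ρ : ℝ → ℝ) (x : stateSpace x₀ y₀) : ℝ :=
  scaleDeriv a b c x / deriv ρ x *
    ∫ t in stateSpace x₀ y₀ ∩ Ioi (x : ℝ),
      (ρ t - ∫ y, ρ y ∂(invMeasure x₀ y₀ a b c)) * speedDeriv a b c t

/-- `C(ρ)`, the supremum of the preceding function. -/
def lipConst (x₀ y₀ : EReal) (a b : ℝ → ℝ) (c : ℝ) (ρ : ℝ → ℝ) : ℝ :=
  ⨆ x, lipRatio x₀ y₀ a b c ρ x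

/-- The function `√a ρ'` on `(x₀, y₀)`; its supremum is `σ`. -/
def gradBound (x₀ y₀ : EReal) (a ρ : ℝ → ℝ) (x : stateSpace x₀ y₀) : ℝ :=
  √(a x) * deriv ρ x

/-- `ρ_a(x) = ∫_c^x a(t)^{-1/2} dt`, which induces the intrinsic metric. -/
def intrinsicCoord (a : ℝ → ℝ) (c x : ℝ) : ℝ := ∫ t in c..x, 1 / √(a t)

end OneDimDiffusion

end

/-! On the line the transport cost is controlled by distribution functions: the monotone (quantile)
coupling gives `W₁(ν, μ) ≤ ∫ ρ' |F_ν - F_μ| dx` for the metric `|ρ x - ρ y|`. If `ν = f μ`, then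
`F_μ(x) - F_ν(x)` is the integral of `f(t) - f(s)` over `s ≤ x < t` against `μ ⊗ μ`. Bounding `|f(t)
- f(s)|` by `∫_s^t g` and applying Tonelli moves the derivative from `ρ` to `f`: `W₁ ≤ ∫ g(y) k(y)
dy`, where `k(y)` integrates `ρ(t) - ρ(s)` over `s < y ≤ t` (`wassersteinOne_le_lintegral_kernel`).

This kernel equals `∫_{[y, ∞)} (ρ - μ(ρ)) dμ`, the quantity inside `C(ρ)` up to explicit factors.
Since `s' a m' = 1`, the definition of `C(ρ)` gives `k ≤ C(ρ) a ρ' m' / Z` (`lintegral_kernel_le`).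
With `h = √f` and `g = 2 h |h'|`, the bound `√a ρ' ≤ σ` yields `W₁ ≤ 2 σ C(ρ) ∫ h √a |h'| dμ`, and
Cauchy–Schwarz together with `∫ h² dμ = 1` finishes (`wassersteinOne_sq_le`). The intrinsic
coordinate is the case `σ = 1`. -/

section MonotoneCoupling

open ProbabilityTheory Filter Topology

/-! ### Quantile functions and the monotone coupling -/

/-- The quantile function of a measure on the real line. -/
noncomputable def quantile (ν : Measure ℝ) (u : ℝ) : ℝ := sInf {t | u ≤ cdf ν t}

/-- Right continuity of the distribution function makes the infimum attained. The restriction `0 < u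
< 1` makes the set nonempty and bounded below, so `sInf` takes no default value. -/
theorem quantile_le_iff (ν : Measure ℝ) {u : ℝ} (hu : u ∈ Ioo (0 : ℝ) 1) (t : ℝ) :
    quantile ν u ≤ t ↔ u ≤ cdf ν t := by
  have hne : {t | u ≤ cdf ν t}.Nonempty := by
    obtain ⟨s, hs⟩ := ((tendsto_cdf_atTop ν).eventually (lt_mem_nhds hu.2)).exists
    exact ⟨s, hs.le⟩
  have hbdd : BddBelow {t | u ≤ cdf ν t} := by
    obtain ⟨s, hs⟩ := ((tendsto_cdf_atBot ν).eventually (gt_mem_nhds hu.1)).exists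
    refine ⟨s, fun t ht => ?_⟩
    by_contra! h
    exact absurd (ht.trans (monotone_cdf ν h.le)) (not_le.2 hs)
  refine ⟨fun h => ?_, fun h => csInf_le hbdd h⟩
  have hlim : Tendsto (cdf ν) (𝓝[>] t) (𝓝 (cdf ν t)) :=
    ((cdf ν).right_continuous t).tendsto.mono_left (nhdsWithin_mono _ Ioi_subset_Ici_self)
  refine ge_of_tendsto hlim ?_
  filter_upwards [self_mem_nhdsWithin] with s hs
  obtain ⟨v, hv, hvs⟩ := exists_lt_of_csInf_lt hne (lt_of_le_of_lt h hs)
  exact le_trans hv (monotone_cdf ν hvs.le)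

theorem aemeasurable_quantile (ν : Measure ℝ) :
    AEMeasurable (quantile ν) (volume.restrict (Ioo (0 : ℝ) 1)) := by
  refine aemeasurable_restrict_of_monotoneOn measurableSet_Ioo fun u hu v hv huv => ?_
  rw [quantile_le_iff ν hu]
  exact huv.trans ((quantile_le_iff ν hv _).1 le_rfl)

/-- By the Galois connection, the preimage of `Iic t` is `{u ≤ F(t)}` within `(0, 1)`, of length
`F(t)`; half-lines determine a finite measure. -/
theorem map_quantile (ν : Measure ℝ) [IsProbabilityMeasure ν] :
    (volume.restrict (Ioo (0 : ℝ) 1)).map (quantile ν) = ν := by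
  have : IsFiniteMeasure ((volume.restrict (Ioo (0 : ℝ) 1)).map (quantile ν)) := inferInstance
  refine Measure.ext_of_Iic _ _ fun t => ?_
  rw [Measure.map_apply_of_aemeasurable (aemeasurable_quantile ν) measurableSet_Iic,
    ← ofReal_cdf ν t]
  have h : (volume.restrict (Ioo (0 : ℝ) 1)) (quantile ν ⁻¹' Iic t) =
      (volume.restrict (Ioo (0 : ℝ) 1)) (Iic (cdf ν t)) := by
    refine measure_congr ?_
    filter_upwards [ae_restrict_mem measurableSet_Ioo] with u hu
    exact propext (quantile_le_iff ν hu t)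
  rw [h, Measure.restrict_apply measurableSet_Iic]
  refine le_antisymm ?_ ?_
  · calc volume (Iic (cdf ν t) ∩ Ioo 0 1) ≤ volume (Ioc 0 (cdf ν t)) :=
          measure_mono (fun u hu => ⟨hu.2.1, hu.1⟩)
      _ = _ := by rw [Real.volume_Ioc, sub_zero]
  · calc ENNReal.ofReal (cdf ν t) = volume (Ioo 0 (cdf ν t)) := by rw [Real.volume_Ioo, sub_zero]
      _ ≤ volume (Iic (cdf ν t) ∩ Ioo 0 1) :=
          measure_mono (fun u hu => ⟨hu.2.le, hu.1, hu.2.trans_le (cdf_le_one ν t)⟩)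

/-- The monotone coupling of two probability measures on the line. -/
theorem exists_monotone_coupling (ν μ : Measure ℝ) [IsProbabilityMeasure ν]
    [IsProbabilityMeasure μ] :
    ∃ π : Measure (ℝ × ℝ), SFinite π ∧ IsCoupling π ν μ ∧
      ∀ t, π {p | p.1 ≤ t ∧ t < p.2} + π {p | p.2 ≤ t ∧ t < p.1} ≤ ‖cdf ν t - cdf μ t‖ₑ := by
  have hmν := aemeasurable_quantile ν
  have hmμ := aemeasurable_quantile μ
  refine ⟨(volume.restrict (Ioo (0 : ℝ) 1)).map fun u => (quantile ν u, quantile μ u),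
    inferInstance, ⟨?_, ?_⟩, fun t => ?_⟩
  · rw [AEMeasurable.map_map_of_aemeasurable measurable_fst.aemeasurable (hmν.prodMk hmμ)]
    exact map_quantile ν
  · rw [AEMeasurable.map_map_of_aemeasurable measurable_snd.aemeasurable (hmν.prodMk hmμ)]
    exact map_quantile μ
  -- The quantiles straddle `t` only when `u` lies between the two values of the distribution
  -- functions at `t`. Of the two orders, one has a nonpositive difference and hence measure zero.
  · have key : ∀ ν₁ ν₂ : Measure ℝ, (volume.restrict (Ioo (0 : ℝ) 1))
        {u | quantile ν₁ u ≤ t ∧ t < quantile ν₂ u} ≤ ENNReal.ofReal (cdf ν₁ t - cdf ν₂ t) := by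
      intro ν₁ ν₂
      rw [← Real.volume_Ioc]
      refine (measure_mono_ae ?_).trans (Measure.restrict_apply_le _ _)
      filter_upwards [ae_restrict_mem measurableSet_Ioo] with u hu hut
      have h2 := hut.2
      rw [← not_le, quantile_le_iff ν₂ hu, not_le] at h2
      exact ⟨h2, (quantile_le_iff ν₁ hu t).1 hut.1⟩
    have m1 : MeasurableSet {p : ℝ × ℝ | p.1 ≤ t ∧ t < p.2} :=
      (measurableSet_le measurable_fst measurable_const).inter
        (measurableSet_lt measurable_const measurable_snd)
    have m2 : MeasurableSet {p : ℝ × ℝ | p.2 ≤ t ∧ t < p.1} :=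
      (measurableSet_le measurable_snd measurable_const).inter
        (measurableSet_lt measurable_const measurable_fst)
    rw [Measure.map_apply_of_aemeasurable (hmν.prodMk hmμ) m1,
      Measure.map_apply_of_aemeasurable (hmν.prodMk hmμ) m2]
    refine (add_le_add (key ν μ) (key μ ν)).trans ?_
    rw [Real.enorm_eq_ofReal_abs]
    rcases le_total (cdf ν t) (cdf μ t) with h | h
    · rw [ENNReal.ofReal_of_nonpos (sub_nonpos.2 h), abs_of_nonpos (sub_nonpos.2 h), zero_add,
        neg_sub]
    · rw [ENNReal.ofReal_of_nonpos (p := cdf μ t - cdf ν t) (sub_nonpos.2 h),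
        abs_of_nonneg (sub_nonneg.2 h), add_zero]

/-! ### Transport cost via distribution functions and the covariance kernel -/

theorem measurableSet_setOf_le_and_lt {X : Type*} [MeasurableSpace X] {f₁ g₁ f₂ g₂ : X → ℝ}
    (hf₁ : Measurable f₁) (hg₁ : Measurable g₁) (hf₂ : Measurable f₂) (hg₂ : Measurable g₂) :
    MeasurableSet {q | f₁ q ≤ g₁ q ∧ f₂ q < g₂ q} :=
  (measurableSet_le hf₁ hg₁).inter (measurableSet_lt hf₂ hg₂)

theorem measurableSet_setOf_lt_and_le {X : Type*} [MeasurableSpace X] {f₁ g₁ f₂ g₂ : X → ℝ}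
    (hf₁ : Measurable f₁) (hg₁ : Measurable g₁) (hf₂ : Measurable f₂) (hg₂ : Measurable g₂) :
    MeasurableSet {q | f₁ q < g₁ q ∧ f₂ q ≤ g₂ q} :=
  (measurableSet_lt hf₁ hg₁).inter (measurableSet_le hf₂ hg₂)

/-- The transport cost for `|ρ x - ρ y|` is at most the `ρ'`-weighted `L¹` distance of the
distribution functions. -/
theorem wassersteinOne_le_lintegral_cdf {S : Set ℝ} (ν μ : Measure ℝ) [IsProbabilityMeasure ν]
    [IsProbabilityMeasure μ] (hν : ∀ᵐ x ∂ν, x ∈ S) (hμ : ∀ᵐ x ∂μ, x ∈ S) {ρ : ℝ → ℝ}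
    {r : ℝ → ℝ≥0∞} (hr : Measurable r) (hmono : MonotoneOn ρ S)
    (hρ : ∀ z ∈ S, ∀ w ∈ S, z ≤ w → ENNReal.ofReal (ρ w - ρ z) = ∫⁻ x in Ico z w, r x) :
    wassersteinOne (fun x y => |ρ x - ρ y|) ν μ ≤ ∫⁻ x, r x * ‖cdf ν x - cdf μ x‖ₑ := by
  obtain ⟨π, _, hπ, hle⟩ := exists_monotone_coupling ν μ
  refine (iInf₂_le π hπ).trans ?_
  have h1 : ∀ᵐ p ∂π, p.1 ∈ S := ae_of_ae_map measurable_fst.aemeasurable (hπ.1.symm ▸ hν)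
  have h2 : ∀ᵐ p ∂π, p.2 ∈ S := ae_of_ae_map measurable_snd.aemeasurable (hπ.2.symm ▸ hμ)
  have m1 : MeasurableSet {q : (ℝ × ℝ) × ℝ | q.1.1 ≤ q.2 ∧ q.2 < q.1.2} :=
    measurableSet_setOf_le_and_lt (by fun_prop) (by fun_prop) (by fun_prop) (by fun_prop)
  have m2 : MeasurableSet {q : (ℝ × ℝ) × ℝ | q.1.2 ≤ q.2 ∧ q.2 < q.1.1} :=
    measurableSet_setOf_le_and_lt (by fun_prop) (by fun_prop) (by fun_prop) (by fun_prop)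
  have n1 : ∀ x : ℝ, MeasurableSet {p : ℝ × ℝ | p.1 ≤ x ∧ x < p.2} := fun x =>
    measurableSet_setOf_le_and_lt (by fun_prop) (by fun_prop) (by fun_prop) (by fun_prop)
  have n2 : ∀ x : ℝ, MeasurableSet {p : ℝ × ℝ | p.2 ≤ x ∧ x < p.1} := fun x =>
    measurableSet_setOf_le_and_lt (by fun_prop) (by fun_prop) (by fun_prop) (by fun_prop)
  -- `G p` is `r` restricted to the half-open interval between the coordinates of `p`, in whichever
  -- order they come. Indicators on the triple product give the joint measurability that Tonelli
  -- needs.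
  let G : ℝ × ℝ → ℝ → ℝ≥0∞ := fun p x =>
    {q : (ℝ × ℝ) × ℝ | q.1.1 ≤ q.2 ∧ q.2 < q.1.2}.indicator (fun q => r q.2) (p, x) +
    {q : (ℝ × ℝ) × ℝ | q.1.2 ≤ q.2 ∧ q.2 < q.1.1}.indicator (fun q => r q.2) (p, x)
  have hG : Measurable (Function.uncurry G) :=
    ((hr.comp measurable_snd).indicator m1).add ((hr.comp measurable_snd).indicator m2)
  calc ∫⁻ p, ENNReal.ofReal |ρ p.1 - ρ p.2| ∂π ≤ ∫⁻ p, (∫⁻ x, G p x) ∂π := by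
        refine lintegral_mono_ae ?_
        filter_upwards [h1, h2] with p hp1 hp2
        rcases le_total p.1 p.2 with h | h
        · rw [abs_sub_comm, abs_of_nonneg (sub_nonneg.2 (hmono hp1 hp2 h)), hρ _ hp1 _ hp2 h,
            ← lintegral_indicator measurableSet_Ico]
          exact lintegral_mono fun x => le_self_add
        · rw [abs_of_nonneg (sub_nonneg.2 (hmono hp2 hp1 h)), hρ _ hp2 _ hp1 h,
            ← lintegral_indicator measurableSet_Ico]
          exact lintegral_mono fun x => le_add_self
    _ = ∫⁻ x, ∫⁻ p, G p x ∂π := lintegral_lintegral_swap hG.aemeasurable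
    _ ≤ ∫⁻ x, r x * ‖cdf ν x - cdf μ x‖ₑ := by
        refine lintegral_mono fun x => ?_
        have e : ∀ p, G p x = {p : ℝ × ℝ | p.1 ≤ x ∧ x < p.2}.indicator (fun _ => r x) p +
            {p : ℝ × ℝ | p.2 ≤ x ∧ x < p.1}.indicator (fun _ => r x) p := fun p => rfl
        simp only [e]
        rw [lintegral_add_left (measurable_const.indicator (n1 x)),
          lintegral_indicator_const (n1 x), lintegral_indicator_const (n2 x), ← mul_add]
        gcongr
        exact hle x

/-- Applied twice: to the density `f`, to recover the difference of distribution functions, and to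
`ρ`, to recover the centered integral in `C(ρ)`. -/
theorem setIntegral_prod_sub (μ : Measure ℝ) [IsProbabilityMeasure μ] {φ : ℝ → ℝ}
    (hφ : Integrable φ μ) (s t : Set ℝ) :
    ∫ p in s ×ˢ t, (φ p.2 - φ p.1) ∂(μ.prod μ) =
      μ.real s * ∫ y in t, φ y ∂μ - μ.real t * ∫ y in s, φ y ∂μ := by
  rw [← Measure.prod_restrict, integral_sub, integral_fun_snd, integral_fun_fst]
  · simp
  · exact (hφ.restrict (s := t)).comp_snd _
  · exact (hφ.restrict (s := s)).comp_fst _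

/-- The distribution functions of `μ` and of `f μ` differ at most by the oscillation of `f`
across the point. -/
theorem enorm_cdf_sub_cdf_le (ν μ : Measure ℝ) [IsProbabilityMeasure ν] [IsProbabilityMeasure μ]
    {f : ℝ → ℝ} (hf : Measurable f) (hf0 : ∀ x, 0 ≤ f x)
    (hν : ν = μ.withDensity fun x => ENNReal.ofReal (f x)) (x : ℝ) :
    ‖cdf ν x - cdf μ x‖ₑ ≤ ∫⁻ p in Iic x ×ˢ Ioi x, ‖f p.2 - f p.1‖ₑ ∂(μ.prod μ) := by
  have hint : Integrable f μ := by
    rw [← lintegral_ofReal_ne_top_iff_integrable hf.aestronglyMeasurable (ae_of_all _ hf0),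
      ← setLIntegral_univ, ← withDensity_apply _ MeasurableSet.univ, ← hν]
    exact measure_ne_top _ _
  have hset : ∀ s, MeasurableSet s → ν.real s = ∫ y in s, f y ∂μ := by
    intro s hs
    rw [integral_eq_lintegral_of_nonneg_ae (ae_of_all _ hf0) hf.aestronglyMeasurable,
      ← withDensity_apply _ hs, ← hν]
    rfl
  have hc : ∀ m : Measure ℝ, IsProbabilityMeasure m → m.real (Ioi x) = 1 - m.real (Iic x) := by
    intro m _
    rw [← compl_Iic, probReal_compl_eq_one_sub measurableSet_Iic]
  have key := setIntegral_prod_sub μ hint (Iic x) (Ioi x)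
  rw [← hset _ measurableSet_Iic, ← hset _ measurableSet_Ioi, hc ν inferInstance,
    hc μ inferInstance] at key
  -- The double integral equals `F_μ(x) - F_ν(x)`, hence the change of sign.
  rw [cdf_eq_real, cdf_eq_real, ← enorm_neg]
  refine le_trans (le_of_eq ?_) (enorm_integral_le_lintegral_enorm _)
  rw [key]
  congr 1
  ring

/-- The transport cost between `μ` and `f μ` in terms of a dominating derivative `g` of `f`. -/
theorem wassersteinOne_le_lintegral_kernel {S : Set ℝ} (ν μ : Measure ℝ) [IsProbabilityMeasure ν]
    [IsProbabilityMeasure μ] (hμ : ∀ᵐ x ∂μ, x ∈ S) {ρ f : ℝ → ℝ}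
    {r g : ℝ → ℝ≥0∞} (hr : Measurable r) (hg : Measurable g) (hmono : MonotoneOn ρ S)
    (hρ : ∀ z ∈ S, ∀ w ∈ S, z ≤ w → ENNReal.ofReal (ρ w - ρ z) = ∫⁻ x in Ico z w, r x)
    (hf : Measurable f) (hf0 : ∀ x, 0 ≤ f x)
    (hν : ν = μ.withDensity fun x => ENNReal.ofReal (f x))
    (hfg : ∀ z ∈ S, ∀ w ∈ S, z ≤ w → ‖f w - f z‖ₑ ≤ ∫⁻ y in Ioc z w, g y) :
    wassersteinOne (fun x y => |ρ x - ρ y|) ν μ ≤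
      ∫⁻ y, g y * ∫⁻ p in Iio y ×ˢ Ici y, ENNReal.ofReal (ρ p.2 - ρ p.1) ∂(μ.prod μ) := by
  have hνS : ∀ᵐ x ∂ν, x ∈ S := by
    rw [hν]
    exact (withDensity_absolutelyContinuous _ _).ae_le hμ
  have hS1 : ∀ᵐ p ∂(μ.prod μ), p.1 ∈ S := Measure.quasiMeasurePreserving_fst.ae hμ
  have hS2 : ∀ᵐ p ∂(μ.prod μ), p.2 ∈ S := Measure.quasiMeasurePreserving_snd.ae hμ
  have mA : MeasurableSet {q : (ℝ × ℝ) × ℝ | q.1.1 ≤ q.2 ∧ q.2 < q.1.2} :=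
    measurableSet_setOf_le_and_lt (by fun_prop) (by fun_prop) (by fun_prop) (by fun_prop)
  have mB : MeasurableSet {q : (ℝ × ℝ) × ℝ | q.1.1 < q.2 ∧ q.2 ≤ q.1.2} :=
    measurableSet_setOf_lt_and_le (by fun_prop) (by fun_prop) (by fun_prop) (by fun_prop)
  -- `A` carries `r` on `[p.1, p.2)` and `B` carries `g` on `(p.1, p.2]`. The second convention is
  -- what produces the region `Iio y ×ˢ Ici y` in the kernel.
  let A : ℝ × ℝ → ℝ → ℝ≥0∞ := fun p x =>
    {q : (ℝ × ℝ) × ℝ | q.1.1 ≤ q.2 ∧ q.2 < q.1.2}.indicator (fun q => r q.2) (p, x)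
  let B : ℝ × ℝ → ℝ → ℝ≥0∞ := fun p y =>
    {q : (ℝ × ℝ) × ℝ | q.1.1 < q.2 ∧ q.2 ≤ q.1.2}.indicator (fun q => g q.2) (p, y)
  have hA : Measurable (Function.uncurry A) := (hr.comp measurable_snd).indicator mA
  have hB : Measurable (Function.uncurry B) := (hg.comp measurable_snd).indicator mB
  have hAp : ∀ p, ∫⁻ x, A p x = ∫⁻ x in Ico p.1 p.2, r x := fun p => by
    rw [← lintegral_indicator measurableSet_Ico]; rfl
  have hBp : ∀ p, ∫⁻ x, B p x = ∫⁻ x in Ioc p.1 p.2, g x := fun p => by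
    rw [← lintegral_indicator measurableSet_Ioc]; rfl
  have hIA : Measurable fun p => ∫⁻ x, A p x := hA.lintegral_prod_right'
  have hIB : Measurable fun p => ∫⁻ x, B p x := hB.lintegral_prod_right'
  calc wassersteinOne (fun x y => |ρ x - ρ y|) ν μ
      ≤ ∫⁻ x, r x * ‖cdf ν x - cdf μ x‖ₑ :=
        wassersteinOne_le_lintegral_cdf ν μ hνS hμ hr hmono hρ
    _ ≤ ∫⁻ x, ∫⁻ p, (A p x * ∫⁻ y, B p y) ∂(μ.prod μ) := by
        refine lintegral_mono fun x => ?_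
        calc r x * ‖cdf ν x - cdf μ x‖ₑ
            ≤ r x * ∫⁻ p in Iic x ×ˢ Ioi x, (∫⁻ y, B p y) ∂(μ.prod μ) := by
              gcongr
              refine (enorm_cdf_sub_cdf_le ν μ hf hf0 hν x).trans ?_
              refine lintegral_mono_ae ?_
              filter_upwards [ae_restrict_mem (measurableSet_Iic.prod measurableSet_Ioi),
                ae_restrict_of_ae hS1, ae_restrict_of_ae hS2] with p hp hp1 hp2
              rw [hBp]
              exact hfg _ hp1 _ hp2 (le_trans hp.1 (le_of_lt hp.2))
          _ = ∫⁻ p in Iic x ×ˢ Ioi x, (r x * ∫⁻ y, B p y) ∂(μ.prod μ) :=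
              (lintegral_const_mul _ hIB).symm
          _ = ∫⁻ p, (A p x * ∫⁻ y, B p y) ∂(μ.prod μ) := by
              rw [← lintegral_indicator (measurableSet_Iic.prod measurableSet_Ioi)]
              refine lintegral_congr fun p => ?_
              by_cases hp : p ∈ Iic x ×ˢ Ioi x
              · have hp' : (p, x) ∈ {q : (ℝ × ℝ) × ℝ | q.1.1 ≤ q.2 ∧ q.2 < q.1.2} := hp
                simp only [A, indicator_of_mem hp, indicator_of_mem hp']
              · have hp' : (p, x) ∉ {q : (ℝ × ℝ) × ℝ | q.1.1 ≤ q.2 ∧ q.2 < q.1.2} := hp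
                simp only [A, indicator_of_notMem hp, indicator_of_notMem hp', zero_mul]
    -- For fixed `p` the integrand is a product of two separate integrals. Tonelli brings `x`
    -- inside, and a second application brings `y` outside, exchanging the roles of `r` and `g`.
    _ = ∫⁻ p, (∫⁻ x, A p x * ∫⁻ y, B p y) ∂(μ.prod μ) := by
        refine (lintegral_lintegral_swap ?_).symm
        exact (hA.mul (hIB.comp measurable_fst)).aemeasurable
    _ = ∫⁻ p, (∫⁻ y, B p y * ∫⁻ x, A p x) ∂(μ.prod μ) := by
        refine lintegral_congr fun p => ?_
        have hAm : Measurable (A p) := hA.comp measurable_prodMk_left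
        have hBm : Measurable (B p) := hB.comp measurable_prodMk_left
        rw [lintegral_mul_const _ hAm, lintegral_mul_const _ hBm, mul_comm]
    _ = ∫⁻ y, ∫⁻ p, (B p y * ∫⁻ x, A p x) ∂(μ.prod μ) :=
        lintegral_lintegral_swap (hB.mul (hIA.comp measurable_fst)).aemeasurable
    _ = _ := by
        refine lintegral_congr fun y => ?_
        have hm : MeasurableSet (Iio y ×ˢ Ici y) := measurableSet_Iio.prod measurableSet_Ici
        have e : ∫⁻ p in Iio y ×ˢ Ici y, ENNReal.ofReal (ρ p.2 - ρ p.1) ∂(μ.prod μ) =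
            ∫⁻ p in Iio y ×ˢ Ici y, (∫⁻ x, A p x) ∂(μ.prod μ) := by
          refine lintegral_congr_ae ?_
          filter_upwards [ae_restrict_mem hm,
            ae_restrict_of_ae hS1, ae_restrict_of_ae hS2] with p hp hp1 hp2
          rw [hAp]
          exact hρ _ hp1 _ hp2 (le_trans (le_of_lt hp.1) hp.2)
        rw [e, ← lintegral_const_mul _ hIA, ← lintegral_indicator hm]
        refine lintegral_congr fun p => ?_
        by_cases hp : p ∈ Iio y ×ˢ Ici y
        · have hp' : (p, y) ∈ {q : (ℝ × ℝ) × ℝ | q.1.1 < q.2 ∧ q.2 ≤ q.1.2} := hp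
          simp only [B, indicator_of_mem hp, indicator_of_mem hp']
        · have hp' : (p, y) ∉ {q : (ℝ × ℝ) × ℝ | q.1.1 < q.2 ∧ q.2 ≤ q.1.2} := hp
          simp only [B, indicator_of_notMem hp, indicator_of_notMem hp', zero_mul]

/-- Both sides reduce to `∫_{Ici y} φ dμ - μ(Ici y) ∫ φ dμ`, because `μ` has total mass one. -/
theorem setIntegral_prod_sub_eq_setIntegral_centered (μ : Measure ℝ) [IsProbabilityMeasure μ]
    {φ : ℝ → ℝ} (hφ : Integrable φ μ) (y : ℝ) :
    ∫ p in Iio y ×ˢ Ici y, (φ p.2 - φ p.1) ∂(μ.prod μ) =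
      ∫ t in Ici y, (φ t - ∫ u, φ u ∂μ) ∂μ := by
  rw [setIntegral_prod_sub μ hφ, integral_sub hφ.integrableOn (integrable_const _),
    ← compl_Ici, probReal_compl_eq_one_sub measurableSet_Ici,
    ← integral_add_compl measurableSet_Ici hφ]
  simp
  ring

end MonotoneCoupling

namespace OneDimDiffusion

/-! ### The interval, the scale and speed densities, and the invariant measure -/

theorem isOpen_stateSpace (x₀ y₀ : EReal) : IsOpen (stateSpace x₀ y₀) :=
  (isOpen_lt continuous_const continuous_coe_real_ereal).inter
    (isOpen_lt continuous_coe_real_ereal continuous_const)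

theorem ordConnected_stateSpace (x₀ y₀ : EReal) : (stateSpace x₀ y₀).OrdConnected :=
  ⟨fun _ hx _ hy _ hz => ⟨hx.1.trans_le (EReal.coe_le_coe_iff.2 hz.1),
    (EReal.coe_le_coe_iff.2 hz.2).trans_lt hy.2⟩⟩

theorem hasDerivAt_primitive {S : Set ℝ} (hS : IsOpen S) (hS' : S.OrdConnected) {c : ℝ}
    (hc : c ∈ S) {φ : ℝ → ℝ} (hφ : ContinuousOn φ S) {x : ℝ} (hx : x ∈ S) :
    HasDerivAt (fun x => ∫ t in c..x, φ t) (φ x) x :=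
  intervalIntegral.integral_hasDerivAt_right
    (hφ.mono (hS'.uIcc_subset hc hx)).intervalIntegrable
    (hφ.stronglyMeasurableAtFilter hS x hx) (hφ.continuousAt (hS.mem_nhds hx))

variable {x₀ y₀ : EReal} {a b : ℝ → ℝ} {c : ℝ}

theorem speedDeriv_pos (ha_pos : ∀ x ∈ stateSpace x₀ y₀, 0 < a x) {x : ℝ}
    (hx : x ∈ stateSpace x₀ y₀) : 0 < speedDeriv a b c x :=
  mul_pos (one_div_pos.2 (ha_pos x hx)) (Real.exp_pos _)

/-- The two exponentials cancel. This identity trades the factor `1 / s'` coming from `C(ρ)` for `a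
m'`, which is `a` times the unnormalised density of `μ`. -/
theorem scaleDeriv_mul_speedDeriv (ha_pos : ∀ x ∈ stateSpace x₀ y₀, 0 < a x) {x : ℝ}
    (hx : x ∈ stateSpace x₀ y₀) : scaleDeriv a b c x * (a x * speedDeriv a b c x) = 1 := by
  have := (ha_pos x hx).ne'
  rw [speedDeriv, scaleDeriv, ← mul_assoc (a x), mul_one_div_cancel this, one_mul, ← Real.exp_add,
    neg_add_cancel, Real.exp_zero]

theorem continuousOn_speedDeriv (hc : c ∈ stateSpace x₀ y₀)
    (ha : ContinuousOn a (stateSpace x₀ y₀)) (hb : ContinuousOn b (stateSpace x₀ y₀))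
    (ha_pos : ∀ x ∈ stateSpace x₀ y₀, 0 < a x) :
    ContinuousOn (speedDeriv a b c) (stateSpace x₀ y₀) := by
  have hne : ∀ x ∈ stateSpace x₀ y₀, a x ≠ 0 := fun x hx => (ha_pos x hx).ne'
  refine (continuousOn_const.div ha hne).mul (Real.continuous_exp.comp_continuousOn ?_)
  exact fun x hx => (hasDerivAt_primitive (isOpen_stateSpace x₀ y₀)
    (ordConnected_stateSpace x₀ y₀) hc (hb.div ha hne) hx).continuousAt.continuousWithinAt

theorem integrableOn_speedDeriv (hc : c ∈ stateSpace x₀ y₀)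
    (ha : ContinuousOn a (stateSpace x₀ y₀)) (hb : ContinuousOn b (stateSpace x₀ y₀))
    (ha_pos : ∀ x ∈ stateSpace x₀ y₀, 0 < a x) (hZ : FiniteSpeed x₀ y₀ a b c) :
    IntegrableOn (speedDeriv a b c) (stateSpace x₀ y₀) := by
  have hm := (isOpen_stateSpace x₀ y₀).measurableSet
  refine (lintegral_ofReal_ne_top_iff_integrable
    ((continuousOn_speedDeriv hc ha hb ha_pos).aestronglyMeasurable hm) ?_).1 hZ.ne
  filter_upwards [ae_restrict_mem hm] with x hx
  exact (speedDeriv_pos ha_pos hx).le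

theorem speedMass_pos (hc : c ∈ stateSpace x₀ y₀)
    (ha : ContinuousOn a (stateSpace x₀ y₀)) (hb : ContinuousOn b (stateSpace x₀ y₀))
    (ha_pos : ∀ x ∈ stateSpace x₀ y₀, 0 < a x) (hZ : FiniteSpeed x₀ y₀ a b c) :
    0 < speedMass x₀ y₀ a b c := by
  have hO := isOpen_stateSpace x₀ y₀
  refine (setIntegral_pos_iff_support_of_nonneg_ae ?_
    (integrableOn_speedDeriv hc ha hb ha_pos hZ)).2 ?_
  · filter_upwards [ae_restrict_mem hO.measurableSet] with x hx
    exact (speedDeriv_pos ha_pos hx).le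
  · have hsub : stateSpace x₀ y₀ ⊆ Function.support (speedDeriv a b c) :=
      fun x hx => (speedDeriv_pos ha_pos hx).ne'
    rw [inter_eq_right.2 hsub]
    exact hO.measure_pos volume ⟨c, hc⟩

theorem invMeasure_absolutelyContinuous :
    invMeasure x₀ y₀ a b c ≪ volume.restrict (stateSpace x₀ y₀) :=
  withDensity_absolutelyContinuous _ _

theorem ae_mem_stateSpace : ∀ᵐ x ∂(invMeasure x₀ y₀ a b c), x ∈ stateSpace x₀ y₀ :=
  invMeasure_absolutelyContinuous.ae_le
    (ae_restrict_mem (isOpen_stateSpace x₀ y₀).measurableSet)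

theorem aemeasurable_density (hc : c ∈ stateSpace x₀ y₀)
    (ha : ContinuousOn a (stateSpace x₀ y₀)) (hb : ContinuousOn b (stateSpace x₀ y₀))
    (ha_pos : ∀ x ∈ stateSpace x₀ y₀, 0 < a x) :
    AEMeasurable (fun x => ENNReal.ofReal (speedDeriv a b c x / speedMass x₀ y₀ a b c))
      (volume.restrict (stateSpace x₀ y₀)) :=
  (((continuousOn_speedDeriv hc ha hb ha_pos).aemeasurable
    (isOpen_stateSpace x₀ y₀).measurableSet).div_const _).ennreal_ofReal

theorem isProbabilityMeasure_invMeasure (hc : c ∈ stateSpace x₀ y₀)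
    (ha : ContinuousOn a (stateSpace x₀ y₀)) (hb : ContinuousOn b (stateSpace x₀ y₀))
    (ha_pos : ∀ x ∈ stateSpace x₀ y₀, 0 < a x) (hZ : FiniteSpeed x₀ y₀ a b c) :
    IsProbabilityMeasure (invMeasure x₀ y₀ a b c) := by
  have hp := speedMass_pos hc ha hb ha_pos hZ
  refine ⟨?_⟩
  rw [invMeasure, withDensity_apply _ MeasurableSet.univ, Measure.restrict_univ,
    ← ofReal_integral_eq_lintegral_ofReal, integral_div]
  · rw [← speedMass, div_self hp.ne', ENNReal.ofReal_one]
  · exact (integrableOn_speedDeriv hc ha hb ha_pos hZ).div_const _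
  · filter_upwards [ae_restrict_mem (isOpen_stateSpace x₀ y₀).measurableSet] with x hx
    exact div_nonneg (speedDeriv_pos ha_pos hx).le hp.le

theorem restrict_absolutelyContinuous_invMeasure (hc : c ∈ stateSpace x₀ y₀)
    (ha : ContinuousOn a (stateSpace x₀ y₀)) (hb : ContinuousOn b (stateSpace x₀ y₀))
    (ha_pos : ∀ x ∈ stateSpace x₀ y₀, 0 < a x) (hZ : FiniteSpeed x₀ y₀ a b c) :
    volume.restrict (stateSpace x₀ y₀) ≪ invMeasure x₀ y₀ a b c := by
  refine withDensity_absolutelyContinuous' (aemeasurable_density hc ha hb ha_pos) ?_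
  filter_upwards [ae_restrict_mem (isOpen_stateSpace x₀ y₀).measurableSet] with x hx
  exact (ENNReal.ofReal_pos.2 (div_pos (speedDeriv_pos ha_pos hx)
    (speedMass_pos hc ha hb ha_pos hZ))).ne'

theorem invMeasure_pos_of_isOpen (hc : c ∈ stateSpace x₀ y₀)
    (ha : ContinuousOn a (stateSpace x₀ y₀)) (hb : ContinuousOn b (stateSpace x₀ y₀))
    (ha_pos : ∀ x ∈ stateSpace x₀ y₀, 0 < a x) (hZ : FiniteSpeed x₀ y₀ a b c) {U : Set ℝ}
    (hU : IsOpen U) (hne : (U ∩ stateSpace x₀ y₀).Nonempty) : 0 < invMeasure x₀ y₀ a b c U := by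
  rw [pos_iff_ne_zero]
  intro h
  have := restrict_absolutelyContinuous_invMeasure hc ha hb ha_pos hZ h
  rw [Measure.restrict_apply hU.measurableSet] at this
  exact (hU.inter (isOpen_stateSpace x₀ y₀)).measure_ne_zero volume hne this

/-! ### The constant `C(ρ)` and the covariance kernel -/

/-- The integral in the definition of `lipRatio` as an integral against `μ`. -/
theorem setIntegral_Ici_invMeasure (hc : c ∈ stateSpace x₀ y₀)
    (ha : ContinuousOn a (stateSpace x₀ y₀)) (hb : ContinuousOn b (stateSpace x₀ y₀))
    (ha_pos : ∀ x ∈ stateSpace x₀ y₀, 0 < a x) (hZ : FiniteSpeed x₀ y₀ a b c) (φ : ℝ → ℝ)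
    (y : ℝ) :
    ∫ t in Ici y, φ t ∂(invMeasure x₀ y₀ a b c) =
      (∫ t in stateSpace x₀ y₀ ∩ Ioi y, φ t * speedDeriv a b c t) / speedMass x₀ y₀ a b c := by
  have hS := (isOpen_stateSpace x₀ y₀).measurableSet
  have hr : (volume.restrict (stateSpace x₀ y₀)).restrict (Ici y) =
      volume.restrict (stateSpace x₀ y₀ ∩ Ioi y) := by
    rw [Measure.restrict_restrict measurableSet_Ici, inter_comm]
    exact Measure.restrict_congr_set ((ae_eq_refl _).inter Ioi_ae_eq_Ici.symm)
  rw [invMeasure, restrict_withDensity measurableSet_Ici, hr,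
    integral_withDensity_eq_integral_toReal_smul₀, ← integral_div]
  · refine setIntegral_congr_fun (hS.inter measurableSet_Ioi) fun t ht => ?_
    simp only [smul_eq_mul]
    rw [ENNReal.toReal_ofReal (div_nonneg (speedDeriv_pos ha_pos ht.1).le
      (speedMass_pos hc ha hb ha_pos hZ).le)]
    ring
  · exact (aemeasurable_density hc ha hb ha_pos).mono_measure
      (Measure.restrict_mono inter_subset_left le_rfl)
  · exact ae_of_all _ fun _ => ENNReal.ofReal_lt_top

/-- `lipRatio` in terms of the covariance of `ρ` with the indicator of a half-line. -/
theorem lipRatio_eq (hc : c ∈ stateSpace x₀ y₀)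
    (ha : ContinuousOn a (stateSpace x₀ y₀)) (hb : ContinuousOn b (stateSpace x₀ y₀))
    (ha_pos : ∀ x ∈ stateSpace x₀ y₀, 0 < a x) (hZ : FiniteSpeed x₀ y₀ a b c) {ρ : ℝ → ℝ}
    (hρ : Integrable ρ (invMeasure x₀ y₀ a b c)) (y : stateSpace x₀ y₀) :
    lipRatio x₀ y₀ a b c ρ y = scaleDeriv a b c y / deriv ρ y * (speedMass x₀ y₀ a b c *
      ∫ p in Iio (y : ℝ) ×ˢ Ici (y : ℝ), (ρ p.2 - ρ p.1)
        ∂((invMeasure x₀ y₀ a b c).prod (invMeasure x₀ y₀ a b c))) := by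
  have := isProbabilityMeasure_invMeasure hc ha hb ha_pos hZ
  rw [setIntegral_prod_sub_eq_setIntegral_centered _ hρ,
    setIntegral_Ici_invMeasure hc ha hb ha_pos hZ,
    mul_div_cancel₀ _ (speedMass_pos hc ha hb ha_pos hZ).ne', lipRatio]

theorem integrable_prod_sub (μ : Measure ℝ) [IsProbabilityMeasure μ] {φ : ℝ → ℝ}
    (hφ : Integrable φ μ) : Integrable (fun p : ℝ × ℝ => φ p.2 - φ p.1) (μ.prod μ) :=
  (hφ.comp_snd μ).sub (hφ.comp_fst μ)

theorem strictMonoOn_of_deriv_pos_stateSpace {ρ : ℝ → ℝ}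
    (hρ : ContDiffOn ℝ 1 ρ (stateSpace x₀ y₀)) (hpos : ∀ x ∈ stateSpace x₀ y₀, 0 < deriv ρ x) :
    StrictMonoOn ρ (stateSpace x₀ y₀) :=
  strictMonoOn_of_deriv_pos (ordConnected_stateSpace x₀ y₀).convex hρ.continuousOn
    (fun x hx => hpos x (interior_subset hx))

theorem ae_mem_prod (μ : Measure ℝ) [IsProbabilityMeasure μ] {S : Set ℝ} (hμ : ∀ᵐ x ∂μ, x ∈ S) :
    ∀ᵐ p ∂(μ.prod μ), p.1 ∈ S ∧ p.2 ∈ S :=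
  (Measure.quasiMeasurePreserving_fst.ae hμ).and (Measure.quasiMeasurePreserving_snd.ae hμ)

/-- The ratio is already positive at `c`: `ρ` is strictly increasing and `μ` charges both sides of
`c`. Positivity keeps the `ENNReal.ofReal` of the constant from collapsing to zero. -/
theorem lipConst_pos (hc : c ∈ stateSpace x₀ y₀)
    (ha : ContinuousOn a (stateSpace x₀ y₀)) (hb : ContinuousOn b (stateSpace x₀ y₀))
    (ha_pos : ∀ x ∈ stateSpace x₀ y₀, 0 < a x) (hZ : FiniteSpeed x₀ y₀ a b c) {ρ : ℝ → ℝ}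
    (hρ : ContDiffOn ℝ 1 ρ (stateSpace x₀ y₀)) (hpos : ∀ x ∈ stateSpace x₀ y₀, 0 < deriv ρ x)
    (hint : Integrable ρ (invMeasure x₀ y₀ a b c))
    (hbdd : BddAbove (range (lipRatio x₀ y₀ a b c ρ))) :
    0 < lipConst x₀ y₀ a b c ρ := by
  have := isProbabilityMeasure_invMeasure hc ha hb ha_pos hZ
  have hO := isOpen_stateSpace x₀ y₀
  have hmono := strictMonoOn_of_deriv_pos_stateSpace hρ hpos
  refine lt_of_lt_of_le ?_ (le_ciSup hbdd ⟨c, hc⟩)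
  rw [lipRatio_eq hc ha hb ha_pos hZ hint]
  refine mul_pos (div_pos (Real.exp_pos _) (hpos c hc))
    (mul_pos (speedMass_pos hc ha hb ha_pos hZ) ?_)
  have hm : MeasurableSet (Iio c ×ˢ Ici c) := measurableSet_Iio.prod measurableSet_Ici
  have hlt : ∀ᵐ p ∂((invMeasure x₀ y₀ a b c).prod (invMeasure x₀ y₀ a b c)),
      p ∈ Iio c ×ˢ Ici c → 0 < ρ p.2 - ρ p.1 := by
    filter_upwards [ae_mem_prod _ (ae_mem_stateSpace (x₀ := x₀) (y₀ := y₀) (a := a) (b := b)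
      (c := c))] with p hp hpc
    exact sub_pos.2 (hmono hp.1 hp.2 (lt_of_lt_of_le hpc.1 hpc.2))
  refine (setIntegral_pos_iff_support_of_nonneg_ae ?_ (integrable_prod_sub _ hint).integrableOn).2 ?_
  · filter_upwards [ae_restrict_mem hm, ae_restrict_of_ae hlt] with p hp hp'
    exact (hp' hp).le
  · obtain ⟨l, u, ⟨hl, hu⟩, hlu⟩ := mem_nhds_iff_exists_Ioo_subset.1 (hO.mem_nhds hc)
    obtain ⟨z, hz⟩ := exists_between hl
    obtain ⟨w, hw⟩ := exists_between hu
    have hpos' : 0 < ((invMeasure x₀ y₀ a b c).prod (invMeasure x₀ y₀ a b c))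
        (Iio c ×ˢ Ici c) := by
      rw [Measure.prod_prod]
      refine ENNReal.mul_pos ?_ ?_
      · exact (invMeasure_pos_of_isOpen hc ha hb ha_pos hZ isOpen_Iio
          ⟨z, hz.2, hlu ⟨hz.1, hz.2.trans hu⟩⟩).ne'
      · exact ((invMeasure_pos_of_isOpen hc ha hb ha_pos hZ isOpen_Ioi
          ⟨w, hw.1, hlu ⟨hl.trans hw.1, hw.2⟩⟩).trans_le (measure_mono Ioi_subset_Ici_self)).ne'
    refine hpos'.trans_le (measure_mono_ae ?_)
    filter_upwards [hlt] with p hp hpc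
    exact ⟨(hp hpc).ne', hpc⟩

/-- The covariance kernel of `ρ` is at most `C(ρ) a ρ' m' / Z`. -/
theorem lintegral_kernel_le (hc : c ∈ stateSpace x₀ y₀)
    (ha : ContinuousOn a (stateSpace x₀ y₀)) (hb : ContinuousOn b (stateSpace x₀ y₀))
    (ha_pos : ∀ x ∈ stateSpace x₀ y₀, 0 < a x) (hZ : FiniteSpeed x₀ y₀ a b c) {ρ : ℝ → ℝ}
    (hρ : ContDiffOn ℝ 1 ρ (stateSpace x₀ y₀)) (hpos : ∀ x ∈ stateSpace x₀ y₀, 0 < deriv ρ x)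
    (hint : Integrable ρ (invMeasure x₀ y₀ a b c))
    (hbdd : BddAbove (range (lipRatio x₀ y₀ a b c ρ))) {y : ℝ} (hy : y ∈ stateSpace x₀ y₀) :
    ∫⁻ p in Iio y ×ˢ Ici y, ENNReal.ofReal (ρ p.2 - ρ p.1)
        ∂((invMeasure x₀ y₀ a b c).prod (invMeasure x₀ y₀ a b c)) ≤
      ENNReal.ofReal (lipConst x₀ y₀ a b c ρ * (a y * deriv ρ y)) *
        ENNReal.ofReal (speedDeriv a b c y / speedMass x₀ y₀ a b c) := by
  have := isProbabilityMeasure_invMeasure hc ha hb ha_pos hZ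
  have hm : MeasurableSet (Iio y ×ˢ Ici y) := measurableSet_Iio.prod measurableSet_Ici
  have hC := lipConst_pos hc ha hb ha_pos hZ hρ hpos hint hbdd
  have hZp := speedMass_pos hc ha hb ha_pos hZ
  rw [← ofReal_integral_eq_lintegral_ofReal (integrable_prod_sub _ hint).integrableOn,
    ← ENNReal.ofReal_mul (mul_nonneg hC.le (mul_nonneg (ha_pos y hy).le (hpos y hy).le))]
  · refine ENNReal.ofReal_le_ofReal ?_
    have h := le_ciSup hbdd ⟨y, hy⟩
    rw [lipRatio_eq hc ha hb ha_pos hZ hint] at h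
    change _ ≤ lipConst x₀ y₀ a b c ρ at h
    have hs := scaleDeriv_mul_speedDeriv (b := b) (c := c) ha_pos hy
    have hs0 : 0 < scaleDeriv a b c y := Real.exp_pos _
    set T := ∫ p in Iio y ×ˢ Ici y, (ρ p.2 - ρ p.1)
        ∂((invMeasure x₀ y₀ a b c).prod (invMeasure x₀ y₀ a b c))
    have hd := hpos y hy
    calc T = (scaleDeriv a b c y / deriv ρ y * (speedMass x₀ y₀ a b c * T)) *
          (deriv ρ y / (scaleDeriv a b c y * speedMass x₀ y₀ a b c)) := by
          field_simp
      _ ≤ lipConst x₀ y₀ a b c ρ *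
          (deriv ρ y / (scaleDeriv a b c y * speedMass x₀ y₀ a b c)) := by
          gcongr
      -- Inserting the factor `s' a m' = 1` cancels the `s'` in the denominator.
      _ = lipConst x₀ y₀ a b c ρ * (deriv ρ y / (scaleDeriv a b c y * speedMass x₀ y₀ a b c)) *
          (scaleDeriv a b c y * (a y * speedDeriv a b c y)) := by rw [hs, mul_one]
      _ = _ := by field_simp
  · filter_upwards [ae_restrict_mem hm, ae_restrict_of_ae (ae_mem_prod _ (ae_mem_stateSpace
      (x₀ := x₀) (y₀ := y₀) (a := a) (b := b) (c := c)))] with p hp hpS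
    exact sub_nonneg.2 ((strictMonoOn_of_deriv_pos_stateSpace hρ hpos).monotoneOn hpS.1 hpS.2
      (le_trans (le_of_lt hp.1) hp.2))

/-! ### Calculus for absolutely continuous functions and Cauchy–Schwarz -/

theorem measurable_indicator_of_continuousOn {S : Set ℝ} (hS : IsOpen S) {φ : ℝ → ℝ}
    (hφ : ContinuousOn φ S) : Measurable (S.indicator φ) := by
  classical
  rw [← piecewise_eq_indicator]
  exact hφ.measurable_piecewise continuousOn_const hS.measurableSet

theorem IsAC.continuousOn {h : ℝ → ℝ} (hh : IsAC x₀ y₀ h) :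
    ContinuousOn h (stateSpace x₀ y₀) := by
  intro x hx
  obtain ⟨l, u, hlu, hsub⟩ := mem_nhds_iff_exists_Ioo_subset.1
    ((isOpen_stateSpace x₀ y₀).mem_nhds hx)
  obtain ⟨z, hz⟩ := exists_between hlu.1
  obtain ⟨w, hw⟩ := exists_between hlu.2
  have hzw := (hh z (hsub ⟨hz.1, hz.2.trans hlu.2⟩) w (hsub ⟨hlu.1.trans hw.1, hw.2⟩)).continuousOn
  rw [uIcc_of_le (hz.2.trans hw.1).le] at hzw
  exact (hzw.continuousAt (Icc_mem_nhds hz.2 hw.1)).continuousWithinAt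

/-- The fundamental theorem of calculus for the square of a locally absolutely continuous
function. -/
theorem IsAC.enorm_sq_sub_sq_le {h : ℝ → ℝ} (hh : IsAC x₀ y₀ h) (hh0 : ∀ x, 0 ≤ h x) {z w : ℝ}
    (hz : z ∈ stateSpace x₀ y₀) (hw : w ∈ stateSpace x₀ y₀) (hzw : z ≤ w) :
    ‖h w ^ 2 - h z ^ 2‖ₑ ≤ ∫⁻ y in Ioc z w, ENNReal.ofReal (2 * h y * |deriv h y|) := by
  have hac := hh z hz w hw
  have h1 := hac.integral_deriv_mul_eq_sub hac
  rw [sq, sq, ← h1, intervalIntegral.integral_of_le hzw]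
  refine (enorm_integral_le_lintegral_enorm _).trans (lintegral_mono fun y => ?_)
  rw [Real.enorm_eq_ofReal_abs]
  refine ENNReal.ofReal_le_ofReal (le_of_eq ?_)
  rw [show deriv h y * h y + h y * deriv h y = 2 * h y * deriv h y by ring, abs_mul,
    abs_of_nonneg (mul_nonneg zero_le_two (hh0 y))]

theorem ofReal_sub_eq_lintegral_deriv {S : Set ℝ} (hS : IsOpen S) (hS' : S.OrdConnected)
    {ρ : ℝ → ℝ} (hρ : ContDiffOn ℝ 1 ρ S) (hpos : ∀ x ∈ S, 0 < deriv ρ x) {z w : ℝ}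
    (hz : z ∈ S) (hw : w ∈ S) (hzw : z ≤ w) :
    ENNReal.ofReal (ρ w - ρ z) = ∫⁻ x in Ico z w, ENNReal.ofReal (deriv ρ x) := by
  have hsub : uIcc z w ⊆ S := hS'.uIcc_subset hz hw
  have hcont : ContinuousOn (deriv ρ) S := hρ.continuousOn_deriv_of_isOpen hS le_rfl
  have hi : IntervalIntegrable (deriv ρ) volume z w := (hcont.mono hsub).intervalIntegrable
  rw [setLIntegral_congr Ico_ae_eq_Ioc, ← intervalIntegral.integral_deriv_eq_sub
    (fun x hx => ((hρ.differentiableOn one_ne_zero).differentiableAt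
      (hS.mem_nhds (hsub hx)))) hi, intervalIntegral.integral_of_le hzw,
    ofReal_integral_eq_lintegral_ofReal hi.1]
  filter_upwards [ae_restrict_mem measurableSet_Ioc] with x hx
  exact (hpos x (hsub (uIoc_subset_uIcc (by rwa [uIoc_of_le hzw])))).le

theorem lintegral_mul_sq_le {α : Type*} [MeasurableSpace α] (μ : Measure α) {f g : α → ℝ≥0∞}
    (hf : AEMeasurable f μ) (hg : AEMeasurable g μ) :
    (∫⁻ x, f x * g x ∂μ) ^ 2 ≤ (∫⁻ x, f x ^ 2 ∂μ) * ∫⁻ x, g x ^ 2 ∂μ := by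
  have h := ENNReal.lintegral_mul_le_Lp_mul_Lq μ Real.HolderConjugate.two_two hf hg
  simp only [Pi.mul_apply, ENNReal.rpow_two] at h
  have hs : ∀ t : ℝ≥0∞, (t ^ (1 / 2 : ℝ)) ^ 2 = t := fun t => by
    rw [← ENNReal.rpow_two, ← ENNReal.rpow_mul]
    norm_num
  calc _ ≤ _ := pow_le_pow_left' h 2
    _ = _ := by rw [mul_pow, hs, hs]

/-! ### The transportation-information inequality -/

/-- The transportation-information bound for a single version of the density. -/
theorem wassersteinOne_sq_le (hc : c ∈ stateSpace x₀ y₀)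
    (ha : ContinuousOn a (stateSpace x₀ y₀)) (hb : ContinuousOn b (stateSpace x₀ y₀))
    (ha_pos : ∀ x ∈ stateSpace x₀ y₀, 0 < a x) (hZ : FiniteSpeed x₀ y₀ a b c) {ρ : ℝ → ℝ}
    (hρ : ContDiffOn ℝ 1 ρ (stateSpace x₀ y₀)) (hpos : ∀ x ∈ stateSpace x₀ y₀, 0 < deriv ρ x)
    (hint : Integrable ρ (invMeasure x₀ y₀ a b c))
    (hbdd : BddAbove (range (lipRatio x₀ y₀ a b c ρ))) {σ : ℝ}
    (hσ : ∀ x ∈ stateSpace x₀ y₀, √(a x) * deriv ρ x ≤ σ) {ν : Measure ℝ}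
    [IsProbabilityMeasure ν] {f : ℝ → ℝ} (hf0 : ∀ x, 0 ≤ f x)
    (hν : ν = (invMeasure x₀ y₀ a b c).withDensity fun x => ENNReal.ofReal (f x))
    (hf : IsAC x₀ y₀ fun x => √(f x)) :
    wassersteinOne (fun x y => |ρ x - ρ y|) ν (invMeasure x₀ y₀ a b c) ^ 2 ≤
      4 * ENNReal.ofReal (σ * lipConst x₀ y₀ a b c ρ) ^ 2 *
        energy x₀ y₀ a b c fun x => √(f x) := by
  have := isProbabilityMeasure_invMeasure hc ha hb ha_pos hZ
  have hO := isOpen_stateSpace x₀ y₀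
  have hOC := ordConnected_stateSpace x₀ y₀
  have hC := lipConst_pos hc ha hb ha_pos hZ hρ hpos hint hbdd
  have hσ0 : 0 ≤ σ := le_trans (mul_nonneg (Real.sqrt_nonneg _) (hpos c hc).le) (hσ c hc)
  have hS : ∀ᵐ x ∂(invMeasure x₀ y₀ a b c), x ∈ stateSpace x₀ y₀ := ae_mem_stateSpace
  set S := stateSpace x₀ y₀
  set μ := invMeasure x₀ y₀ a b c
  set h : ℝ → ℝ := fun x => √(f x)
  set C := lipConst x₀ y₀ a b c ρ
  have hh0 : ∀ x, 0 ≤ h x := fun x => Real.sqrt_nonneg _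
  -- Measurability of `f` is not given, but `√f` is continuous on `S`. Cutting it off outside `S`
  -- gives a measurable function whose square is still a density of `ν`, as `μ` is carried by `S`.
  have hhm : Measurable (S.indicator h) := measurable_indicator_of_continuousOn hO hf.continuousOn
  have hk0 : ∀ x, 0 ≤ S.indicator h x := indicator_nonneg fun x _ => hh0 x
  have hgm : Measurable fun y => ENNReal.ofReal (2 * S.indicator h y * |deriv h y|) :=
    ((measurable_const.mul hhm).mul (measurable_deriv h).norm).ennreal_ofReal
  have hrm : Measurable (S.indicator fun x => ENNReal.ofReal (deriv ρ x)) :=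
    (measurable_deriv ρ).ennreal_ofReal.indicator hO.measurableSet
  have hνf : ν = μ.withDensity fun x => ENNReal.ofReal (S.indicator h x ^ 2) := by
    rw [hν]
    refine withDensity_congr_ae ?_
    filter_upwards [hS] with x hx
    rw [indicator_of_mem hx, Real.sq_sqrt (hf0 x)]
  have hfm : Measurable fun x => S.indicator h x ^ 2 := hhm.pow_const 2
  have h1 := wassersteinOne_le_lintegral_kernel ν μ hS (ρ := ρ) hrm hgm
    (strictMonoOn_of_deriv_pos_stateSpace hρ hpos).monotoneOn
    (fun z hz w hw hzw => by
      rw [ofReal_sub_eq_lintegral_deriv hO hOC hρ hpos hz hw hzw]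
      refine setLIntegral_congr_fun measurableSet_Ico fun x hx => ?_
      have hxS : x ∈ S := hOC.out hz hw ⟨hx.1, hx.2.le⟩
      simp only [indicator_of_mem hxS])
    hfm (fun x => sq_nonneg _) hνf
    (fun z hz w hw hzw => by
      rw [indicator_of_mem hz, indicator_of_mem hw]
      refine (hf.enorm_sq_sub_sq_le hh0 hz hw hzw).trans (le_of_eq ?_)
      refine setLIntegral_congr_fun measurableSet_Ioc fun x hx => ?_
      have hxS : x ∈ S := hOC.out hz hw ⟨hx.1.le, hx.2⟩
      simp only [indicator_of_mem hxS])
  have ham : AEMeasurable a μ :=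
    (ha.aemeasurable hO.measurableSet).mono_ac invMeasure_absolutelyContinuous
  have hu : AEMeasurable (fun x => ENNReal.ofReal (S.indicator h x)) μ :=
    hhm.ennreal_ofReal.aemeasurable
  have hv : AEMeasurable (fun x => ENNReal.ofReal (√(a x) * |deriv h x|)) μ :=
    (ham.sqrt.mul (measurable_deriv h).norm.aemeasurable).ennreal_ofReal
  have h2 : wassersteinOne (fun x y => |ρ x - ρ y|) ν μ ≤
      ENNReal.ofReal (2 * (σ * C)) * ∫⁻ x, ENNReal.ofReal (S.indicator h x) *
        ENNReal.ofReal (√(a x) * |deriv h x|) ∂μ := by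
    refine h1.trans ?_
    rw [← lintegral_const_mul' _ _ ENNReal.ofReal_ne_top]
    refine le_of_le_of_eq ?_ (lintegral_withDensity_eq_lintegral_mul₀'
      (aemeasurable_density hc ha hb ha_pos) ((hu.mul hv).const_mul _)).symm
    rw [← lintegral_indicator hO.measurableSet]
    refine lintegral_mono fun y => ?_
    by_cases hy : y ∈ S
    · rw [indicator_of_mem hy, indicator_of_mem hy]
      refine (mul_le_mul_right (lintegral_kernel_le hc ha hb ha_pos hZ hρ hpos hint hbdd hy)
        _).trans ?_
      rw [← mul_assoc, mul_comm, Pi.mul_apply]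
      refine mul_le_mul_right ?_ _
      have hay := (ha_pos y hy).le
      have hd := (hpos y hy).le
      rw [← ENNReal.ofReal_mul (by have := hh0 y; positivity), Pi.mul_apply, indicator_of_mem hy,
        ← ENNReal.ofReal_mul (hh0 y),
        ← ENNReal.ofReal_mul (by positivity)]
      refine ENNReal.ofReal_le_ofReal ?_
      -- Split `a = √a · √a`: one factor joins `ρ'` and is bounded by `σ`, the other stays with
      -- `|h'|` to form the energy.
      calc 2 * h y * |deriv h y| * (C * (a y * deriv ρ y))
          = (2 * h y * |deriv h y| * C * √(a y)) * (√(a y) * deriv ρ y) := by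
            nth_rewrite 1 [← Real.mul_self_sqrt hay]
            ring
        _ ≤ (2 * h y * |deriv h y| * C * √(a y)) * σ := by
            have := hh0 y
            gcongr
            exact hσ y hy
        _ = _ := by ring
    · rw [indicator_of_notMem hy, indicator_of_notMem hy]
      simp
  have h3 : ∫⁻ x, ENNReal.ofReal (S.indicator h x) ^ 2 ∂μ = 1 := by
    rw [← measure_univ (μ := ν), hνf, withDensity_apply _ MeasurableSet.univ,
      Measure.restrict_univ]
    exact lintegral_congr fun x => (ENNReal.ofReal_pow (hk0 x) 2).symm
  have h4 : ∫⁻ x, ENNReal.ofReal (√(a x) * |deriv h x|) ^ 2 ∂μ = energy x₀ y₀ a b c h := by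
    refine lintegral_congr_ae ?_
    filter_upwards [hS] with x hx
    rw [← ENNReal.ofReal_pow (by positivity), mul_pow, Real.sq_sqrt (ha_pos x hx).le, sq_abs]
  calc _ ≤ _ := pow_le_pow_left' h2 2
    _ ≤ ENNReal.ofReal (2 * (σ * C)) ^ 2 * (1 * energy x₀ y₀ a b c h) := by
        rw [mul_pow, ← h3, ← h4]
        exact mul_le_mul_right (lintegral_mul_sq_le μ hu hv) _
    _ = _ := by
        rw [one_mul, ENNReal.ofReal_mul zero_le_two, mul_pow, ENNReal.ofReal_ofNat]
        norm_num

/-- The transportation-information inequality under a bound on `√a ρ'`. -/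
theorem satisfiesW1I_of_gradBound_le (hc : c ∈ stateSpace x₀ y₀)
    (ha : ContinuousOn a (stateSpace x₀ y₀)) (hb : ContinuousOn b (stateSpace x₀ y₀))
    (ha_pos : ∀ x ∈ stateSpace x₀ y₀, 0 < a x) (hZ : FiniteSpeed x₀ y₀ a b c) {ρ : ℝ → ℝ}
    (hρ : ContDiffOn ℝ 1 ρ (stateSpace x₀ y₀)) (hpos : ∀ x ∈ stateSpace x₀ y₀, 0 < deriv ρ x)
    (hint : Integrable ρ (invMeasure x₀ y₀ a b c))
    (hbdd : BddAbove (range (lipRatio x₀ y₀ a b c ρ))) {σ : ℝ}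
    (hσ : ∀ x ∈ stateSpace x₀ y₀, √(a x) * deriv ρ x ≤ σ) :
    SatisfiesW1I x₀ y₀ a b c ρ (σ * lipConst x₀ y₀ a b c ρ) := by
  intro ν _ _
  have hσ0 : 0 < σ :=
    lt_of_lt_of_le (mul_pos (Real.sqrt_pos.2 (ha_pos c hc)) (hpos c hc)) (hσ c hc)
  have hK := mul_pos hσ0 (lipConst_pos hc ha hb ha_pos hZ hρ hpos hint hbdd)
  -- A nonzero finite constant passes inside the infimum defining the Fisher information, even when
  -- no admissible density exists and the infimum is `∞`. It remains to treat each version `f`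
  -- separately.
  have hne : 4 * ENNReal.ofReal (σ * lipConst x₀ y₀ a b c ρ) ^ 2 ≠ 0 :=
    mul_ne_zero four_ne_zero (pow_ne_zero 2 (ENNReal.ofReal_pos.2 hK).ne')
  have htop : 4 * ENNReal.ofReal (σ * lipConst x₀ y₀ a b c ρ) ^ 2 ≠ ∞ :=
    ENNReal.mul_ne_top (by norm_num) (ENNReal.pow_ne_top ENNReal.ofReal_ne_top)
  rw [fisherInfo, ENNReal.mul_iInf_of_ne hne htop]
  refine le_iInf fun f => ?_
  rw [ENNReal.mul_iInf_of_ne hne htop]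
  refine le_iInf fun hf => ?_
  exact wassersteinOne_sq_le hc ha hb ha_pos hZ hρ hpos hint hbdd hσ hf.1 hf.2.1 hf.2.2.1

/-! ### The intrinsic coordinate and the final statement -/

theorem hasDerivAt_intrinsicCoord (hc : c ∈ stateSpace x₀ y₀)
    (ha : ContinuousOn a (stateSpace x₀ y₀)) (ha_pos : ∀ x ∈ stateSpace x₀ y₀, 0 < a x) {x : ℝ}
    (hx : x ∈ stateSpace x₀ y₀) : HasDerivAt (intrinsicCoord a c) (1 / √(a x)) x :=
  hasDerivAt_primitive (isOpen_stateSpace x₀ y₀) (ordConnected_stateSpace x₀ y₀) hc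
    (continuousOn_const.div ha.sqrt fun x hx => (Real.sqrt_pos.2 (ha_pos x hx)).ne') hx

theorem contDiffOn_intrinsicCoord (hc : c ∈ stateSpace x₀ y₀)
    (ha : ContinuousOn a (stateSpace x₀ y₀)) (ha_pos : ∀ x ∈ stateSpace x₀ y₀, 0 < a x) :
    ContDiffOn ℝ 1 (intrinsicCoord a c) (stateSpace x₀ y₀) := by
  have hd := fun x hx => hasDerivAt_intrinsicCoord (x := x) hc ha ha_pos hx
  rw [show (1 : WithTop ℕ∞) = 0 + 1 from rfl,
    contDiffOn_succ_iff_deriv_of_isOpen (isOpen_stateSpace x₀ y₀)]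
  refine ⟨fun x hx => (hd x hx).differentiableAt.differentiableWithinAt, by simp, ?_⟩
  rw [contDiffOn_zero]
  refine ContinuousOn.congr (f := fun x => 1 / √(a x)) ?_ fun x hx => (hd x hx).deriv
  exact continuousOn_const.div ha.sqrt fun x hx => (Real.sqrt_pos.2 (ha_pos x hx)).ne'

end OneDimDiffusion

theorem corollary3p2 (x₀ y₀ : EReal) (a b : ℝ → ℝ) (c : ℝ)
    (hc : c ∈ OneDimDiffusion.stateSpace x₀ y₀)
    (ha : ContinuousOn a (OneDimDiffusion.stateSpace x₀ y₀))
    (hb : ContinuousOn b (OneDimDiffusion.stateSpace x₀ y₀))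
    (ha_pos : ∀ x ∈ OneDimDiffusion.stateSpace x₀ y₀, 0 < a x)
    (hZ : OneDimDiffusion.FiniteSpeed x₀ y₀ a b c)
    (hacc : OneDimDiffusion.NonAccessible x₀ y₀ a b c) :
    (∀ ρ : ℝ → ℝ,
      ContDiffOn ℝ 1 ρ (OneDimDiffusion.stateSpace x₀ y₀) →
      (∀ x ∈ OneDimDiffusion.stateSpace x₀ y₀, 0 < deriv ρ x) →
      MemLp ρ 2 (OneDimDiffusion.invMeasure x₀ y₀ a b c) →
      BddAbove (range (OneDimDiffusion.lipRatio x₀ y₀ a b c ρ)) →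
      BddAbove (range (OneDimDiffusion.gradBound x₀ y₀ a ρ)) →
      OneDimDiffusion.SatisfiesW1I x₀ y₀ a b c ρ
        ((⨆ x, OneDimDiffusion.gradBound x₀ y₀ a ρ x) *
          OneDimDiffusion.lipConst x₀ y₀ a b c ρ)) ∧
    (Integrable (OneDimDiffusion.intrinsicCoord a c)
        (OneDimDiffusion.invMeasure x₀ y₀ a b c) →
      BddAbove (range (OneDimDiffusion.lipRatio x₀ y₀ a b c
        (OneDimDiffusion.intrinsicCoord a c))) →
      OneDimDiffusion.SatisfiesW1I x₀ y₀ a b c (OneDimDiffusion.intrinsicCoord a c)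
        (OneDimDiffusion.lipConst x₀ y₀ a b c (OneDimDiffusion.intrinsicCoord a c))) := by
  refine ⟨fun ρ hρ hpos hL2 hbdd hgrad => ?_, fun hint hbdd => ?_⟩
  · have := OneDimDiffusion.isProbabilityMeasure_invMeasure hc ha hb ha_pos hZ
    exact OneDimDiffusion.satisfiesW1I_of_gradBound_le hc ha hb ha_pos hZ hρ hpos
      (hL2.integrable one_le_two) hbdd fun x hx => le_ciSup hgrad ⟨x, hx⟩
  · have hd := fun x hx => (OneDimDiffusion.hasDerivAt_intrinsicCoord (x := x) hc ha ha_pos hx).deriv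
    have hs := fun x hx => Real.sqrt_pos.2 (ha_pos x hx)
    -- Here `σ = 1`, since `√a ρ_a' = 1` throughout the interval.
    rw [← one_mul (OneDimDiffusion.lipConst x₀ y₀ a b c (OneDimDiffusion.intrinsicCoord a c))]
    refine OneDimDiffusion.satisfiesW1I_of_gradBound_le hc ha hb ha_pos hZ
      (OneDimDiffusion.contDiffOn_intrinsicCoord hc ha ha_pos) (fun x hx => ?_) hint hbdd
      fun x hx => ?_
    · rw [hd x hx]
      exact one_div_pos.2 (hs x hx)
    · rw [hd x hx, mul_one_div_cancel (hs x hx).ne']
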